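/- Let $r\ge 0$ and $p\ge 1$ be integers, and let $f\in D^{r,1}([0,1]) = C^r([0,1])\cap C^{r+2}_{pw}([0,1])$; that is, $f$ is real valued and $C^r$ on $[0,1]$, and there are $0=t_0<\dots<t_N=1$ such that $f$ is $C^{r+2}$ on each $(t_j,t_{j+1})$ and $f^{(r+2)}|_{(t_j,t_{j+1})}$ extends continuously to $[t_j,t_{j+1}]$. For $1\le m\le r$ let $a^m_0,\dots,a^m_{m+p-1}$ be real coefficients, independent of $n$, such that the one-sided difference operators $$\mathcal D^{m,\pm}_{n,p}(g)(x) = (\pm n)^m\sum_{k=0}^{m+p-1} a^m_k\, g\!\left(x\pm \tfrac kn\right)$$ approximate the $m$-th derivative with order of accuracy $p$: for every $g\in C^\infty(\mathbb R)$ and $x\in\mathbb R$, $\mathcal D^{m,\pm}_{n,p}(g)(x)-g^{(m)}(x)=\mathcal O(n^{-p})$ as $n\to\infty$. For $n\ge \max\{1,r+p-1\}$ let $F_{n,p}=(f_{i,m})_{i\in\{0,1\},\,0\le m\le r}$ be given by $f_{0,0}=f(0)$, $f_{1,0}=f(1)$, and $f_{0,m}=\mathcal D^{m,+}_{n,p}(f)(0)$,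 $f_{1,m}=\mathcal D^{m,-}_{n,p}(f)(1)$ for $1\le m\le r$. Let $$\mathcal P_r(F)(x)=(1+x)^{r+1}\sum_{m=0}^r\frac{f_{0,m}}{m!}\sum_{i=0}^{r-m}(-1)^i\binom{r+i}{i}x^{m+i}+(-x)^{r+1}\sum_{m=0}^r\frac{f_{1,m}}{m!}\sum_{i=0}^{r-m}\binom{r+i}{i}(1+x)^{m+i}$$ be the two-point Hermite interpolation polynomial at $0$ and $-1$, where $F=(f_{i,m})$. Define the continued grid data by $(\hat f^d_c)_j=f(j/n)$ for $0\le j\le n$ and $(\hat f^d_c)_j=\mathcal P_r(F_{n,p})(j/n)$ for $-n\le j\le -1$. Put $$c^d_k(\hat f^d_c)=\frac1{2n}\sum_{j=-n}^{n-1}(\hat f^d_c)_j\,e^{-\pi i jk/n},\qquad \mathcal T^d_{n,2}(\hat f^d_c)(x)=\sum_{k=-n}^{n-1}c^d_k(\hat f^d_c)\,e^{\pi i kx}.$$ Then there is a constant $C>0$, independent of $n$, such that for all $n\ge \max\{1,r+p-1\}$ $$\bigl\|\mathcal T^d_{n,2}(\hat f^d_c)-f\bigr\|_{\infty,[0,1]}\le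 \frac{C}{n^{\min\{p,r\}+1}}.$$ -/

import Mathlib

namespace FourierContinuation

/-- `f` is piecewise `C^ℓ` on `[a,b]`: there are finitely many break points
`a = t 0 < t 1 < ⋯ < t N = b` such that on every open piece `f` has `ℓ` continuous derivatives and
the restriction of `f^(ℓ)` to the open piece extends continuously to the closed piece. -/
def PiecewiseCk (ℓ : ℕ) (f : ℝ → ℝ) (a b : ℝ) : Prop :=
  ∃ (N : ℕ) (t : Fin (N + 1) → ℝ), StrictMono t ∧ t 0 = a ∧ t (Fin.last N) = b ∧
    ∀ j : Fin N,
      ContDiffOn ℝ ℓ f (Set.Ioo (t j.castSucc) (t j.succ)) ∧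
      ∃ h : ℝ → ℝ, ContinuousOn h (Set.Icc (t j.castSucc) (t j.succ)) ∧
        Set.EqOn (iteratedDeriv ℓ f) h (Set.Ioo (t j.castSucc) (t j.succ))

/-- The space `D^{r,1}([a,b])` of functions that are `C^r` on `[a,b]` and piecewise `C^{r+2}`. -/
def MemD (r : ℕ) (f : ℝ → ℝ) (a b : ℝ) : Prop :=
  ContDiffOn ℝ r f (Set.Icc a b) ∧ PiecewiseCk (r + 2) f a b

/-- The one-sided finite difference operator of the `m`-th derivative with `m + p` nodes,
step `1 / n` and coefficients `c 0, …, c (m + p - 1)`; forward for `σ = 1`, backward for `σ = -1`: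
`(σ n)^m ∑_{k=0}^{m+p-1} c_k g(x + σ k / n)`. -/
noncomputable def finiteDiff (σ : ℝ) (m p : ℕ) (c : ℕ → ℝ) (n : ℕ) (g : ℝ → ℝ) (x : ℝ) : ℝ :=
  (σ * n) ^ m * ∑ k ∈ Finset.range (m + p), c k * g (x + σ * (k / n))

/-- The forward and the backward difference operators with coefficients `c` approximate the `m`-th
derivative with order of accuracy `p`: for smooth functions the error is `O(n^{-p})`. -/
def HasAccuracy (m p : ℕ) (c : ℕ → ℝ) : Prop :=
  ∀ σ : ℝ, σ = 1 ∨ σ = -1 → ∀ g : ℝ → ℝ, ContDiff ℝ ((⊤ : ℕ∞) : WithTop ℕ∞) g → ∀ x : ℝ,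
    (fun n : ℕ => finiteDiff σ m p c n g x - iteratedDeriv m g x)
      =O[Filter.atTop] (fun n : ℕ => 1 / (n : ℝ) ^ p)

/-- The two-point Hermite interpolation polynomial `P_r(F)` of degree at most `2 r + 1`, whose
derivatives up to order `r` at `0` and at `-1` are the rows `F 0` and `F 1`. -/
noncomputable def hermite (r : ℕ) (F : Matrix (Fin 2) (Fin (r + 1)) ℝ) (x : ℝ) : ℝ :=
  (1 + x) ^ (r + 1) * ∑ m : Fin (r + 1), F 0 m / (m : ℕ).factorial *
      ∑ i ∈ Finset.range (r - m + 1), (-1) ^ i * ((r + i).choose i : ℝ) * x ^ ((m : ℕ) + i)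
  + (-x) ^ (r + 1) * ∑ m : Fin (r + 1), F 1 m / (m : ℕ).factorial *
      ∑ i ∈ Finset.range (r - m + 1), ((r + i).choose i : ℝ) * (1 + x) ^ ((m : ℕ) + i)

/-- The approximate boundary data matrix `F_{n,p}`: the column `0` holds the exact values `f 0`,
`f 1`; the column `m ≥ 1` holds the forward difference at `0` and the backward difference at `1`
with coefficients `a m`. -/
noncomputable def boundaryData (r p : ℕ) (a : ℕ → ℕ → ℝ) (n : ℕ) (f : ℝ → ℝ) :
    Matrix (Fin 2) (Fin (r + 1)) ℝ :=
  ![fun m => if (m : ℕ) = 0 then f 0 else finiteDiff 1 m p (a m) n f 0,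
    fun m => if (m : ℕ) = 0 then f 1 else finiteDiff (-1) m p (a m) n f 1]

/-- The continued grid data on the points `j / n`, `-n ≤ j ≤ n`. -/
noncomputable def continuedData (r p : ℕ) (a : ℕ → ℕ → ℝ) (n : ℕ) (f : ℝ → ℝ) (j : ℤ) : ℝ :=
  if 0 ≤ j then f (j / n) else hermite r (boundaryData r p a n f) (j / n)

/-- The discrete Fourier coefficient
`c^d_k(u) = (1 / 2n) ∑_{j=-n}^{n-1} u_j e^{-π i j k / n}`. -/
noncomputable def discreteCoeff (n : ℕ) (u : ℤ → ℝ) (k : ℤ) : ℂ :=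
  1 / (2 * n) * ∑ j ∈ Finset.Ico (-(n : ℤ)) n,
    (u j : ℂ) * Complex.exp (-(Real.pi * Complex.I * j * k / n))

/-- The interpolating trigonometric polynomial
`T^d_{n,2}(u)(x) = ∑_{k=-n}^{n-1} c^d_k(u) e^{π i k x}`. -/
noncomputable def trigInterp (n : ℕ) (u : ℤ → ℝ) (x : ℝ) : ℂ :=
  ∑ k ∈ Finset.Ico (-(n : ℤ)) n,
    discreteCoeff n u k * Complex.exp (Real.pi * Complex.I * k * x)

end FourierContinuation

namespace FourierContinuation
open Finset

/-! The grid data are linear in the boundary data. They are therefore the exact data (`f` on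
`[0,1]`, the Hermite polynomial of the true one-sided derivatives on `[-1,0]`) plus, for each `m`,
the errors of the `m`-th differences times Hermite basis polynomials sampled on the negative half
and extended by zero (`trigInterp_continuedData`).

Both kinds of data are samples of continuous 2-periodic functions. If such a function is glued from
two pieces whose derivatives below order `s` match at `0` and at `±1`, integration by parts gives
Fourier coefficients `O(|k|^{-(s+1)})`, and aliasing turns this into a uniform interpolation error
`O(n^{-s})` (`interp_error`, `glued_error`).

For the exact data `s = r + 1` (`MemD.exact_error`). A basis polynomial for the `m`-th derivative is
flat only to order `m` at the ends, so its zero extension has `s = m`; since it vanishes on `[0,1]`,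
its interpolant there is pure error, of size `O(n^{-m})` (`flat_poly_error`). The difference
quotient misses the derivative by `O(n^{m - min(m+p, r+1)})` (`MemD.exists_finiteDiff_bound`). In
the product the powers `n^m` cancel, leaving `O(n^{-min(m+p, r+1)})`. The column `m = 0` is exact,
so `m ≥ 1` and the exponent is at least `min(p, r) + 1`. -/

/-! ### Trigonometric interpolation and aliasing -/

/-- The exponential `e^{π i k x}`. -/
noncomputable def wave (k : ℤ) (x : ℝ) : ℂ := Complex.exp (Real.pi * Complex.I * k * x)

lemma norm_wave (k : ℤ) (x : ℝ) : ‖wave k x‖ = 1 := by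
  rw [wave, show (Real.pi * Complex.I * k * x : ℂ) = ((Real.pi * k * x : ℝ) : ℂ) * Complex.I by
    push_cast; ring]
  exact Complex.norm_exp_ofReal_mul_I _

lemma wave_add (k l : ℤ) (x : ℝ) : wave (k + l) x = wave k x * wave l x := by
  rw [wave, wave, wave, ← Complex.exp_add]
  congr 1
  push_cast
  ring

lemma sum_Ico_neg_self {M : Type*} [AddCommMonoid M] (n : ℕ) (F : ℤ → M) :
    ∑ j ∈ Ico (-(n : ℤ)) n, F j = ∑ i ∈ range (2 * n), F (i - n) := by
  symm
  refine sum_bij (fun i _ => (i : ℤ) - n) ?_ ?_ ?_ ?_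
  · intro i hi
    simp only [mem_range, mem_Ico] at *
    omega
  · intro i _ j _ h
    omega
  · intro j hj
    simp only [mem_Ico] at hj
    refine ⟨(j + n).toNat, ?_, ?_⟩
    · simp only [mem_range]; omega
    · omega
  · intro i _
    rfl

/-- A geometric sum of powers of the `2n`-th root of unity `e^{π i d / n}`, which equals `1` exactly
when `2n` divides `d`. -/
lemma sum_wave_grid (n : ℕ) (hn : 1 ≤ n) (d : ℤ) :
    ∑ j ∈ Ico (-(n : ℤ)) n, wave d (j / n) = if (2 * n : ℤ) ∣ d then (2 * n : ℂ) else 0 := by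
  have hn0 : (n : ℂ) ≠ 0 := by exact_mod_cast (by omega : n ≠ 0)
  set z : ℂ := Complex.exp (Real.pi * Complex.I * d / n) with hz
  have hw : ∀ j : ℤ, wave d (j / n) = z ^ j := by
    intro j
    rw [hz, ← Complex.exp_int_mul, wave]
    congr 1
    push_cast
    field_simp
  have hz0 : z ≠ 0 := Complex.exp_ne_zero _
  have hpi : (Real.pi : ℂ) ≠ 0 := by exact_mod_cast Real.pi_ne_zero
  have hone : z = 1 ↔ (2 * n : ℤ) ∣ d := by
    rw [hz, Complex.exp_eq_one_iff]
    constructor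
    · rintro ⟨m, hm⟩
      refine ⟨m, ?_⟩
      have : (d : ℂ) = 2 * n * m := by
        field_simp at hm
        linear_combination hm
      exact_mod_cast this
    · rintro ⟨m, hm⟩
      refine ⟨m, ?_⟩
      rw [hm]
      push_cast
      field_simp
  have hpow : z ^ (2 * n) = 1 := by
    rw [hz, ← Complex.exp_nat_mul, Complex.exp_eq_one_iff]
    refine ⟨d, ?_⟩
    push_cast
    field_simp
  simp_rw [hw]
  split_ifs with h
  · rw [hone.2 h]
    simp
    norm_cast
    omega
  · rw [sum_Ico_neg_self]
    have : ∀ i : ℕ, z ^ ((i : ℤ) - n) = z ^ i * (z ^ n)⁻¹ := by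
      intro i
      rw [zpow_sub₀ hz0]
      simp [div_eq_mul_inv]
    simp_rw [this, ← sum_mul]
    rw [geom_sum_eq (fun h1 => h (hone.1 h1)), hpow]
    simp

/-- Trigonometric interpolation of complex grid data. -/
noncomputable def interp (n : ℕ) (v : ℤ → ℂ) (x : ℝ) : ℂ :=
  ∑ j ∈ Ico (-(n : ℤ)) n, v j *
    (1 / (2 * n) * ∑ k ∈ Ico (-(n : ℤ)) n, wave (-k) (j / n) * wave k x)

lemma trigInterp_eq_interp (n : ℕ) (u : ℤ → ℝ) (x : ℝ) :
    trigInterp n u x = interp n (fun j => (u j : ℂ)) x := by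
  simp only [trigInterp, interp, discreteCoeff, mul_sum, sum_mul]
  rw [sum_comm]
  refine sum_congr rfl fun j _ => sum_congr rfl fun k _ => ?_
  rw [wave, wave, show (Real.pi * Complex.I * ((-k : ℤ) : ℂ) * ((j / n : ℝ) : ℂ) : ℂ) =
    -(Real.pi * Complex.I * j * k / n) by push_cast; ring]
  ring

/-- Aliasing: on the grid a wave is indistinguishable from the one whose frequency is its residue
modulo `2n` in `[-n, n)`, and discrete orthogonality selects that residue. -/
lemma interp_wave (n : ℕ) (hn : 1 ≤ n) (l : ℤ) (x : ℝ) :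
    ∃ k ∈ Ico (-(n : ℤ)) n, interp n (fun j => wave l (j / n)) x = wave k x ∧
      (l ∈ Ico (-(n : ℤ)) n → k = l) := by
  have hn0 : (n : ℂ) ≠ 0 := by exact_mod_cast (by omega : n ≠ 0)
  have hn' : (0 : ℤ) < 2 * n := by omega
  have key : ∀ k ∈ Ico (-(n : ℤ)) n, (2 * n : ℤ) ∣ l - k ↔ k = (l + n) % (2 * n) - n := by
    intro k hk
    rw [mem_Ico] at hk
    constructor
    · rintro ⟨c, hc⟩
      have : l + n = (k + n) + 2 * n * c := by linarith
      rw [this, Int.add_mul_emod_self_left, Int.emod_eq_of_lt (by omega) (by omega)]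
      ring
    · intro h
      rw [h, show l - ((l + n) % (2 * n) - n) = (l + n) - (l + n) % (2 * n) by ring]
      exact Int.dvd_self_sub_emod
  have hmem : (l + n) % (2 * n) - n ∈ Ico (-(n : ℤ)) n := by
    have h1 := Int.emod_nonneg (l + n) hn'.ne'
    have h2 := Int.emod_lt_of_pos (l + n) hn'
    rw [mem_Ico]
    omega
  refine ⟨_, hmem, ?_, fun hl => ?_⟩
  · have : interp n (fun j => wave l (j / n)) x =
        ∑ k ∈ Ico (-(n : ℤ)) n, (1 / (2 * n) *
          ∑ j ∈ Ico (-(n : ℤ)) n, wave (l - k) (j / n)) * wave k x := by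
      simp only [interp, mul_sum, sum_mul]
      rw [sum_comm]
      refine sum_congr rfl fun k _ => sum_congr rfl fun j _ => ?_
      rw [sub_eq_add_neg, wave_add]
      ring
    rw [this, sum_eq_single_of_mem _ hmem]
    · rw [sum_wave_grid n hn, if_pos ((key _ hmem).2 rfl)]
      field_simp
    · intro k hk hne
      rw [sum_wave_grid n hn, if_neg (fun h => hne ((key k hk).1 h))]
      simp
  · exact ((key l hl).1 (by simp)).symm

/-- The interpolant is a finite combination of grid values, so it commutes with any series
converging at the grid points. -/
lemma hasSum_interp (n : ℕ) (c : ℤ → ℂ) (G : ℝ → ℂ)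
    (hG : ∀ j ∈ Ico (-(n : ℤ)) n, HasSum (fun l => c l * wave l (j / n)) (G (j / n))) (x : ℝ) :
    HasSum (fun l => c l * interp n (fun j => wave l (j / n)) x)
      (interp n (fun j => G (j / n)) x) := by
  have := hasSum_sum (s := Ico (-(n : ℤ)) n) fun j hj => (hG j hj).mul_right
    (1 / (2 * n) * ∑ k ∈ Ico (-(n : ℤ)) n, wave (-k) (j / n) * wave k x)
  refine this.congr_fun ?_ |> fun h => h
  intro l
  simp only [interp, mul_sum]
  refine sum_congr rfl fun j _ => ?_
  refine sum_congr rfl fun k _ => ?_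
  ring

lemma sum_range_tail_le (n : ℕ) (hn : 1 ≤ n) (M : ℕ) :
    ∑ k ∈ range M, (if k < n then (0 : ℝ) else 1 / (k : ℝ) ^ 2) ≤ 2 / n := by
  rw [sum_ite, sum_const_zero, zero_add]
  have h := sum_Ioo_inv_sq_le (α := ℝ) (n - 1) M
  have hc : ((n - 1 : ℕ) : ℝ) + 1 = n := by
    rw [Nat.cast_sub hn]; simp
  rw [hc] at h
  refine le_trans (le_of_eq ?_) h
  refine sum_congr ?_ fun k _ => by simp
  ext k
  simp only [mem_filter, mem_range, mem_Ioo]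
  omega

lemma exists_hasSum_tail (n : ℕ) (hn : 1 ≤ n) :
    ∃ A ≤ 4 / (n : ℝ), HasSum
      (fun l : ℤ => if l ∈ Ico (-(n : ℤ)) n then (0 : ℝ) else 1 / (l : ℝ) ^ 2) A := by
  have h0 : ∀ k : ℕ, (0 : ℝ) ≤ if k < n then (0 : ℝ) else 1 / (k : ℝ) ^ 2 := by
    intro k
    split_ifs <;> positivity
  have hs := summable_of_sum_range_le h0 (sum_range_tail_le n hn)
  have hle := Real.tsum_le_of_sum_range_le h0 (sum_range_tail_le n hn)
  have hb : ∀ k : ℕ, (if (-((k : ℤ) + 1)) ∈ Ico (-(n : ℤ)) n then (0 : ℝ)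
      else 1 / ((-((k : ℤ) + 1) : ℤ) : ℝ) ^ 2) ≤
      if k < n then (0 : ℝ) else 1 / (k : ℝ) ^ 2 := by
    intro k
    by_cases hk : k < n
    · rw [if_pos hk, if_pos]
      rw [mem_Ico]
      omega
    · rw [if_neg hk, if_neg]
      · have : (1 : ℝ) ≤ k := by exact_mod_cast (by omega : 1 ≤ k)
        push_cast
        rw [neg_sq]
        gcongr
        linarith
      · rw [mem_Ico]
        omega
  have hb0 : ∀ k : ℕ, 0 ≤ (if (-((k : ℤ) + 1)) ∈ Ico (-(n : ℤ)) n then (0 : ℝ)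
      else 1 / ((-((k : ℤ) + 1) : ℤ) : ℝ) ^ 2) := by
    intro k
    split_ifs <;> positivity
  have hs2 := Summable.of_nonneg_of_le hb0 hb hs
  have hle2 := hs2.tsum_le_tsum hb hs
  refine ⟨_, ?_, HasSum.of_nat_of_neg_add_one (m := ∑' k : ℕ, if k < n then (0 : ℝ) else
    1 / (k : ℝ) ^ 2) ?_ hs2.hasSum⟩
  · calc _ ≤ 2 / (n : ℝ) + 2 / n := add_le_add hle (hle2.trans hle)
      _ = 4 / n := by ring
  · convert hs.hasSum using 2 with k
    have : ((k : ℤ) ∈ Ico (-(n : ℤ)) n) ↔ k < n := by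
      rw [mem_Ico]
      omega
    simp [this]

/-- Aliasing bound: decay of the coefficients controls the interpolation error. -/
lemma norm_interp_sub_le (s : ℕ) (hs : 1 ≤ s) (c : ℤ → ℂ) (C : ℝ)
    (hc : ∀ k : ℤ, k ≠ 0 → ‖c k‖ ≤ C / |(k : ℝ)| ^ (s + 1)) (G : ℝ → ℂ)
    (hG : ∀ x ∈ Set.Icc (-1 : ℝ) 1, HasSum (fun l => c l * wave l x) (G x))
    (n : ℕ) (hn : 1 ≤ n) (x : ℝ) (hx : x ∈ Set.Icc (-1 : ℝ) 1) :
    ‖interp n (fun j => G (j / n)) x - G x‖ ≤ 8 * C / (n : ℝ) ^ s := by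
  have hn0 : (0 : ℝ) < n := by exact_mod_cast hn
  have hC : 0 ≤ C := by
    have := (norm_nonneg _).trans (hc 1 one_ne_zero)
    simpa using this
  have h1 := hasSum_interp n c G (fun j hj => hG _ (by
    rw [mem_Ico] at hj
    have h1 : (-(n : ℝ)) ≤ j := by exact_mod_cast hj.1
    have h2 : (j : ℝ) ≤ n := by exact_mod_cast hj.2.le
    constructor
    · rw [le_div_iff₀ hn0]; linarith
    · rw [div_le_iff₀ hn0]; linarith)) x
  have h2 := h1.sub (hG x hx)
  obtain ⟨A, hA, hsum⟩ := exists_hasSum_tail n hn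
  -- Of the decay `|l|^{-(s+1)}`, two powers are kept for summation and the other `s - 1` are
  -- bounded using `|l| ≥ n`. The `2` bounds the difference of two unimodular waves; frequencies in
  -- `[-n, n)` contribute nothing.
  have h3 := hsum.mul_left (2 * C / (n : ℝ) ^ (s - 1))
  rw [← h2.tsum_eq]
  refine (tsum_of_norm_bounded h3 fun l => ?_).trans ?_
  · obtain ⟨k, hk, e, hkl⟩ := interp_wave n hn l x
    rw [e, ← mul_sub, norm_mul]
    split_ifs with hl
    · simp [hkl hl]
    · have hln : (n : ℝ) ≤ |(l : ℝ)| := by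
        have : (n : ℤ) ≤ |l| := by
          rw [mem_Ico] at hl
          rw [le_abs]
          omega
        exact_mod_cast this
      have hl0 : l ≠ 0 := by
        rintro rfl
        simp at hln
        omega
      have hw : ‖wave k x - wave l x‖ ≤ 2 := by
        refine (norm_sub_le _ _).trans ?_
        rw [norm_wave, norm_wave]
        norm_num
      have hlp : 0 < |(l : ℝ)| := by positivity
      calc ‖c l‖ * ‖wave k x - wave l x‖ ≤ C / |(l : ℝ)| ^ (s + 1) * 2 := by
            gcongr
            exact hc l hl0
        _ = 2 * C / |(l : ℝ)| ^ (s - 1) * (1 / (l : ℝ) ^ 2) := by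
            rw [← sq_abs (l : ℝ)]
            obtain ⟨t, rfl⟩ : ∃ t, s = t + 1 := ⟨s - 1, by omega⟩
            simp only [Nat.add_sub_cancel]
            field_simp
            ring
        _ ≤ _ := by gcongr
  · calc 2 * C / (n : ℝ) ^ (s - 1) * A ≤ 2 * C / (n : ℝ) ^ (s - 1) * (4 / n) := by gcongr
      _ = 8 * C / (n : ℝ) ^ s := by
        obtain ⟨t, rfl⟩ : ∃ t, s = t + 1 := ⟨s - 1, by omega⟩
        simp only [Nat.add_sub_cancel]
        field_simp
        ring

/-- Uniform error of trigonometric interpolation for a continuous periodic function whose Fourier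
coefficients decay like `|k|^{-(s+1)}`. -/
lemma interp_error (s : ℕ) (hs : 1 ≤ s) (G : ℝ → ℝ) (hcont : ContinuousOn G (Set.Icc (-1) 1))
    (hper : G (-1) = G 1) (C : ℝ)
    (hdec : ∀ k : ℤ, k ≠ 0 → ‖∫ x in (-1 : ℝ)..1, (G x : ℂ) * wave (-k) x‖ ≤
      C / |(k : ℝ)| ^ (s + 1)) (n : ℕ) (hn : 1 ≤ n) (x : ℝ) (hx : x ∈ Set.Icc (-1 : ℝ) 1) :
    ‖interp n (fun j => (G (j / n) : ℂ)) x - G x‖ ≤ 4 * C / (n : ℝ) ^ s := by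
  have : Fact ((0 : ℝ) < 2) := ⟨two_pos⟩
  set g : ℝ → ℂ := fun x => (G x : ℂ) with hg
  have hper' : g (-1) = g (-1 + 2) := by
    rw [hg]; norm_num [hper]
  have hcont' : ContinuousOn g (Set.Icc (-1) (-1 + 2)) := by
    norm_num
    exact Complex.continuous_ofReal.comp_continuousOn hcont
  let F : C(AddCircle (2 : ℝ), ℂ) :=
    ⟨AddCircle.liftIco 2 (-1) g, AddCircle.liftIco_continuous hper' hcont'⟩
  have hcoef : ∀ k : ℤ, fourierCoeff F k = 1 / 2 * ∫ x in (-1 : ℝ)..1, g x * wave (-k) x := by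
    intro k
    have h1 : fourierCoeff F k = _ := fourierCoeff_liftIco_eq g k
    rw [h1, fourierCoeffOn_eq_integral, show (-1 : ℝ) + 2 = 1 by norm_num, Complex.real_smul]
    congr 1
    · norm_num
    · congr 1
      ext x
      rw [fourier_coe_apply, wave, mul_comm, smul_eq_mul, mul_comm]
      congr 2
      push_cast
      ring
  have hnorm : ∀ k : ℤ, k ≠ 0 → ‖fourierCoeff F k‖ ≤ C / 2 / |(k : ℝ)| ^ (s + 1) := by
    intro k hk
    rw [hcoef, norm_mul]
    have := hdec k hk
    norm_num
    calc _ ≤ 1 / 2 * (C / |(k : ℝ)| ^ (s + 1)) := by gcongr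
      _ = _ := by ring
  -- Here `s ≥ 1` makes the exponent `s + 1` at least `2`; summability then yields pointwise
  -- convergence of the Fourier series.
  have hsumm : Summable (fourierCoeff F) := by
    refine Summable.of_norm_bounded_eventually
      (((Real.summable_one_div_int_pow (p := s + 1)).2 (by omega)).abs.mul_left (C / 2)) ?_
    have : {0}ᶜ ∈ (Filter.cofinite : Filter ℤ) := by
      rw [Filter.mem_cofinite, compl_compl]
      exact Set.finite_singleton 0
    filter_upwards [this] with k hk
    refine (hnorm k hk).trans (le_of_eq ?_)
    rw [abs_div, abs_pow, abs_one]
    ring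
  have hF : ∀ x ∈ Set.Icc (-1 : ℝ) 1, F (x : AddCircle (2 : ℝ)) = g x := by
    intro x hx
    rcases hx.2.lt_or_eq with h | h
    · exact AddCircle.liftIco_coe_apply (p := (2 : ℝ)) (a := -1) (f := g) ⟨hx.1, by linarith⟩
    · have : ((x : ℝ) : AddCircle (2 : ℝ)) = ((-1 : ℝ) : AddCircle (2 : ℝ)) := by
        have := AddCircle.coe_add_period (2 : ℝ) (-1)
        rw [← this, h]
        norm_num
      rw [this]
      refine (AddCircle.liftIco_coe_apply (p := (2 : ℝ)) (a := -1) (f := g) ⟨le_rfl, by norm_num⟩).trans ?_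
      rw [h, hper']
      norm_num
  have := norm_interp_sub_le s hs (fourierCoeff F) (C / 2) hnorm g (fun x hx => by
    have := has_pointwise_sum_fourier_series_of_summable hsumm (x : AddCircle (2 : ℝ))
    rw [hF x hx] at this
    convert this using 2 with l
    rw [fourier_coe_apply, wave, smul_eq_mul]
    congr 2
    push_cast
    ring) n hn x hx
  refine this.trans (le_of_eq ?_)
  ring

/-! ### Boundary expansions of Fourier integrals -/

/-- The unnormalised Fourier integral `∫_a^b g(x) e^{-π i k x} dx`. -/
noncomputable def fint (g : ℝ → ℝ) (a b : ℝ) (k : ℤ) : ℂ :=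
  ∫ x in a..b, (g x : ℂ) * wave (-k) x

/-- The boundary terms produced by integrating by parts `s` times. -/
noncomputable def jetSum (s : ℕ) (A B : ℕ → ℝ) (a b : ℝ) (k : ℤ) : ℂ :=
  ∑ i ∈ range s, ((A i : ℂ) * wave (-k) a - B i * wave (-k) b) /
    (Real.pi * Complex.I * k) ^ (i + 1)

lemma continuous_wave (k : ℤ) : Continuous (wave k) := by
  unfold wave
  fun_prop

lemma hasDerivAt_wave (k : ℤ) (x : ℝ) :
    HasDerivAt (wave k) (Real.pi * Complex.I * k * wave k x) x := by
  have h1 : HasDerivAt (fun x : ℝ => (Real.pi * Complex.I * k * x : ℂ))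
      (Real.pi * Complex.I * k * 1) x :=
    (Complex.ofRealCLM.hasDerivAt (x := x)).const_mul _
  have := h1.cexp
  unfold wave
  convert this using 1
  ring

lemma freq_ne_zero {k : ℤ} (hk : k ≠ 0) : (Real.pi * Complex.I * k : ℂ) ≠ 0 := by
  have : (Real.pi : ℂ) ≠ 0 := by exact_mod_cast Real.pi_ne_zero
  simp [this, hk]

lemma abs_le_norm_freq (k : ℤ) : |(k : ℝ)| ≤ ‖(Real.pi * Complex.I * k : ℂ)‖ := by
  rw [norm_mul, norm_mul, Complex.norm_I, Complex.norm_real, Complex.norm_intCast, mul_one,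
    Real.norm_eq_abs, abs_of_pos Real.pi_pos]
  nlinarith [abs_nonneg (k : ℝ), Real.pi_gt_three]

lemma norm_div_freq_le {k : ℤ} (hk : k ≠ 0) (s : ℕ) (z : ℂ) (M : ℝ) (hz : ‖z‖ ≤ M) :
    ‖z / (Real.pi * Complex.I * k) ^ s‖ ≤ M / |(k : ℝ)| ^ s := by
  have hk' : 0 < |(k : ℝ)| := by positivity
  rw [norm_div, norm_pow]
  have hM := (norm_nonneg z).trans hz
  have := abs_le_norm_freq k
  gcongr

lemma fint_parts {g g' : ℝ → ℝ} {a b : ℝ} (hab : a ≤ b) (hg : ContinuousOn g (Set.Icc a b))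
    (hg' : ContinuousOn g' (Set.Icc a b)) (hd : ∀ x ∈ Set.Ioo a b, HasDerivAt g (g' x) x)
    {k : ℤ} (hk : k ≠ 0) :
    fint g a b k = (g a * wave (-k) a - g b * wave (-k) b) / (Real.pi * Complex.I * k) +
      fint g' a b k / (Real.pi * Complex.I * k) := by
  have hw := freq_ne_zero hk
  set w : ℂ := Real.pi * Complex.I * k with hwdef
  have h := intervalIntegral.integral_mul_deriv_eq_deriv_mul_of_hasDerivAt
    (a := a) (b := b) (u := fun x => (g x : ℂ)) (u' := fun x => (g' x : ℂ))
    (v := fun x => -wave (-k) x / w) (v' := wave (-k)) ?_ ?_ ?_ ?_ ?_ ?_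
  · rw [fint, h, fint]
    have : ∀ x, (g' x : ℂ) * (-wave (-k) x / w) = -(g' x * wave (-k) x) / w := by
      intro x; ring
    simp_rw [this, intervalIntegral.integral_div, intervalIntegral.integral_neg]
    ring
  · rw [Set.uIcc_of_le hab]
    exact Complex.continuous_ofReal.comp_continuousOn hg
  · exact ((continuous_wave _).neg.div_const _).continuousOn
  · intro x hx
    rw [min_eq_left hab, max_eq_right hab] at hx
    exact (hd x hx).ofReal_comp
  · intro x _
    have := ((hasDerivAt_wave (-k) x).neg.div_const w)
    have e : wave (-k) x = -(Real.pi * Complex.I * ((-k : ℤ) : ℂ) * wave (-k) x) / w := by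
      rw [eq_div_iff hw, hwdef]
      push_cast
      ring
    rw [e]
    exact this
  · apply ContinuousOn.intervalIntegrable
    rw [Set.uIcc_of_le hab]
    exact Complex.continuous_ofReal.comp_continuousOn hg'
  · exact (continuous_wave _).intervalIntegrable _ _

lemma fint_jets {a b : ℝ} (hab : a ≤ b) (G : ℕ → ℝ → ℝ) (s : ℕ)
    (hc : ∀ i ≤ s, ContinuousOn (G i) (Set.Icc a b))
    (hd : ∀ i < s, ∀ x ∈ Set.Ioo a b, HasDerivAt (G i) (G (i + 1) x) x) {k : ℤ} (hk : k ≠ 0) :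
    fint (G 0) a b k = jetSum s (fun i => G i a) (fun i => G i b) a b k +
      fint (G s) a b k / (Real.pi * Complex.I * k) ^ s := by
  induction s with
  | zero => simp [jetSum]
  | succ s ih =>
    rw [ih (fun i hi => hc i (by omega)) (fun i hi => hd i (by omega)),
      fint_parts hab (hc s (by omega)) (hc (s + 1) le_rfl) (hd s (by omega)) hk, jetSum, jetSum,
      sum_range_succ]
    simp only [add_assoc]
    congr 1
    rw [← add_div, div_div, ← pow_succ', add_div]

lemma norm_fint_le {a b : ℝ} (hab : a ≤ b) {g : ℝ → ℝ} (hg : ContinuousOn g (Set.Icc a b)) :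
    ∃ M, ∀ k, ‖fint g a b k‖ ≤ M := by
  obtain ⟨M, hM⟩ := isCompact_Icc.exists_bound_of_continuousOn hg
  refine ⟨M * |b - a|, fun k => ?_⟩
  refine intervalIntegral.norm_integral_le_of_norm_le_const fun x hx => ?_
  rw [Set.uIoc_of_le hab] at hx
  rw [norm_mul, norm_wave, mul_one, Complex.norm_real]
  exact hM x ⟨hx.1.le, hx.2⟩

/-- The Fourier integrals of `g` over `[a,b]` agree up to `O(|k|^{-(s+1)})` with the first `s`
boundary terms built from the derivatives `A` at `a` and `B` at `b`. -/
def HasExpansion (s : ℕ) (g : ℝ → ℝ) (a b : ℝ) (A B : ℕ → ℝ) : Prop :=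
  ∃ C, ∀ k : ℤ, k ≠ 0 → ‖fint g a b k - jetSum s A B a b k‖ ≤ C / |(k : ℝ)| ^ (s + 1)

lemma norm_boundary_le (u v a b : ℝ) (k : ℤ) :
    ‖(u : ℂ) * wave (-k) a - v * wave (-k) b‖ ≤ |u| + |v| := by
  refine (norm_sub_le _ _).trans ?_
  rw [norm_mul, norm_mul, norm_wave, norm_wave, Complex.norm_real, Complex.norm_real]
  simp

/-- Integrating by parts `s + 1` times, one more than the expansion records: the extra boundary term
and the remaining integral are both `O(|k|^{-(s+1)})`. -/
lemma hasExpansion_of_jets {a b : ℝ} (hab : a ≤ b) (G : ℕ → ℝ → ℝ) (s : ℕ)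
    (hc : ∀ i ≤ s + 1, ContinuousOn (G i) (Set.Icc a b))
    (hd : ∀ i < s + 1, ∀ x ∈ Set.Ioo a b, HasDerivAt (G i) (G (i + 1) x) x) :
    HasExpansion s (G 0) a b (fun i => G i a) (fun i => G i b) := by
  obtain ⟨M, hM⟩ := norm_fint_le hab (hc (s + 1) le_rfl)
  refine ⟨|G s a| + |G s b| + M, fun k hk => ?_⟩
  rw [fint_jets hab G (s + 1) hc hd hk, jetSum, sum_range_succ, jetSum, add_assoc,
    add_sub_cancel_left, ← add_div]
  exact norm_div_freq_le hk _ _ _ ((norm_add_le _ _).trans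
    (add_le_add (norm_boundary_le _ _ _ _ _) (hM k)))

lemma wave_neg_one (k : ℤ) : wave k (-1) = wave k 1 := by
  rw [wave, wave, Complex.exp_eq_exp_iff_exists_int]
  refine ⟨-k, ?_⟩
  push_cast
  ring

lemma continuousOn_glue {p g : ℝ → ℝ} (hp : ContinuousOn p (Set.Icc (-1) 0))
    (hg : ContinuousOn g (Set.Icc 0 1)) (h0 : p 0 = g 0) :
    ContinuousOn (fun x => if 0 ≤ x then g x else p x) (Set.Icc (-1) 1) := by
  have h1 : ContinuousOn (fun x => if 0 ≤ x then g x else p x) (Set.Icc 0 1) :=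
    hg.congr fun x hx => if_pos hx.1
  have h2 : ContinuousOn (fun x => if 0 ≤ x then g x else p x) (Set.Icc (-1) 0) := by
    refine hp.congr fun x hx => ?_
    rcases hx.2.lt_or_eq with h | rfl
    · exact if_neg (not_le.2 h)
    · simp [h0]
  have := h2.union_of_isClosed h1 isClosed_Icc isClosed_Icc
  rwa [Set.Icc_union_Icc_eq_Icc (by norm_num) (by norm_num)] at this

/-- Interpolation error for a function glued from two pieces with matching boundary terms. -/
lemma glued_error (s : ℕ) (hs : 1 ≤ s) {p g : ℝ → ℝ} {A B : ℕ → ℝ}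
    (hp : ContinuousOn p (Set.Icc (-1) 0)) (hg : ContinuousOn g (Set.Icc 0 1))
    (h0 : p 0 = g 0) (h1 : p (-1) = g 1) (hep : HasExpansion s p (-1) 0 A B)
    (heg : HasExpansion s g 0 1 B A) :
    ∃ C, 0 ≤ C ∧ ∀ n : ℕ, 1 ≤ n → ∀ x ∈ Set.Icc (0 : ℝ) 1,
      ‖interp n (fun j => ((if (0 : ℝ) ≤ j / n then g (j / n) else p (j / n) : ℝ) : ℂ)) x - g x‖
        ≤ C / (n : ℝ) ^ s := by
  obtain ⟨C₁, hC₁⟩ := hep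
  obtain ⟨C₂, hC₂⟩ := heg
  set F : ℝ → ℝ := fun x => if 0 ≤ x then g x else p x with hF
  have hcont : ContinuousOn F (Set.Icc (-1) 1) := continuousOn_glue hp hg h0
  have hFp : Set.EqOn F p (Set.Icc (-1) 0) := by
    intro x hx
    rcases hx.2.lt_or_eq with h | rfl
    · exact if_neg (not_le.2 h)
    · simp [hF, h0]
  have hFg : Set.EqOn F g (Set.Icc 0 1) := fun x hx => if_pos hx.1
  have hper : F (-1) = F 1 := by
    rw [hFp (by norm_num), hFg (by norm_num), h1]
  have hdec : ∀ k : ℤ, k ≠ 0 → ‖∫ x in (-1 : ℝ)..1, (F x : ℂ) * wave (-k) x‖ ≤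
      (C₁ + C₂) / |(k : ℝ)| ^ (s + 1) := by
    intro k hk
    have hint : ContinuousOn (fun x => (F x : ℂ) * wave (-k) x) (Set.Icc (-1) 1) :=
      (Complex.continuous_ofReal.comp_continuousOn hcont).mul (continuous_wave _).continuousOn
    have hsplit : ∫ x in (-1 : ℝ)..1, (F x : ℂ) * wave (-k) x =
        fint p (-1) 0 k + fint g 0 1 k := by
      rw [← intervalIntegral.integral_add_adjacent_intervals (b := 0)]
      · congr 1
        · refine intervalIntegral.integral_congr fun x hx => ?_
          rw [Set.uIcc_of_le (by norm_num)] at hx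
          simp only [hFp hx]
        · refine intervalIntegral.integral_congr fun x hx => ?_
          rw [Set.uIcc_of_le (by norm_num)] at hx
          simp only [hFg hx]
      · apply ContinuousOn.intervalIntegrable
        rw [Set.uIcc_of_le (by norm_num)]
        exact hint.mono (Set.Icc_subset_Icc le_rfl (by norm_num))
      · apply ContinuousOn.intervalIntegrable
        rw [Set.uIcc_of_le (by norm_num)]
        exact hint.mono (Set.Icc_subset_Icc (by norm_num) le_rfl)
    -- At `0` both pieces carry `B` with opposite signs; at `-1` and `1` both carry `A`, and the
    -- waves agree there by periodicity.
    have hcancel : jetSum s A B (-1) 0 k + jetSum s B A 0 1 k = 0 := by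
      rw [jetSum, jetSum, ← sum_add_distrib]
      refine sum_eq_zero fun i _ => ?_
      rw [wave_neg_one]
      ring
    rw [hsplit, add_div]
    have := norm_add_le (fint p (-1) 0 k - jetSum s A B (-1) 0 k)
      (fint g 0 1 k - jetSum s B A 0 1 k)
    have e : (fint p (-1) 0 k - jetSum s A B (-1) 0 k) + (fint g 0 1 k - jetSum s B A 0 1 k) =
        fint p (-1) 0 k + fint g 0 1 k := by
      linear_combination -hcancel
    rw [e] at this
    exact this.trans (add_le_add (hC₁ k hk) (hC₂ k hk))
  refine ⟨4 * (C₁ + C₂), ?_, fun n hn x hx => ?_⟩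
  · have := (norm_nonneg _).trans (hdec 1 one_ne_zero)
    simp at this
    positivity
  · have := interp_error s hs F hcont hper _ hdec n hn x ⟨by linarith [hx.1], hx.2⟩
    rwa [hFg hx] at this

/-! ### Hermite basis polynomials and their jets -/

open Polynomial in
/-- The truncation at degree `L` of the power series of `(1 - X)^{-(r+1)}`. -/
noncomputable def truncNegBinomial (r L : ℕ) : ℝ[X] :=
  ∑ i ∈ range (L + 1), C ((r + i).choose i : ℝ) * X ^ i

open Polynomial in
lemma one_sub_X_mul_truncNegBinomial (r L : ℕ) :
    (1 - X) * truncNegBinomial (r + 1) L =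
      truncNegBinomial r L - C ((r + 1 + L).choose L : ℝ) * X ^ (L + 1) := by
  induction L with
  | zero => simp [truncNegBinomial]
  | succ L ih =>
    have h : ((r + 1 + (L + 1)).choose (L + 1) : ℝ) =
        (r + 1 + L).choose L + (r + (L + 1)).choose (L + 1) := by
      rw [show r + 1 + (L + 1) = (r + 1 + L) + 1 by ring, Nat.choose_succ_succ,
        show r + (L + 1) = r + 1 + L by ring]
      push_cast
      ring
    rw [truncNegBinomial, sum_range_succ, mul_add, ← truncNegBinomial, ih,
      truncNegBinomial.eq_1 r (L + 1), sum_range_succ, ← truncNegBinomial, h]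
    simp only [map_add]
    ring

-- The truncated series inverts `(1 - X)^(r+1)` modulo `X^(L+1)`. Each induction step removes one
-- factor `1 - X` at the cost of a multiple of `X^(L+1)`.
open Polynomial in
lemma X_pow_dvd_truncNegBinomial (r L : ℕ) :
    (X : ℝ[X]) ^ (L + 1) ∣ (1 - X) ^ (r + 1) * truncNegBinomial r L - 1 := by
  induction r with
  | zero =>
    refine ⟨-1, ?_⟩
    have := mul_neg_geom_sum (X : ℝ[X]) (L + 1)
    simp only [truncNegBinomial, zero_add, Nat.choose_self, Nat.cast_one, map_one, one_mul, pow_one]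
    rw [this]
    ring
  | succ r ih =>
    rw [pow_succ (1 - X : ℝ[X]), mul_assoc, one_sub_X_mul_truncNegBinomial]
    have : (1 - X) ^ (r + 1) * (truncNegBinomial r L - C ((r + 1 + L).choose L : ℝ) * X ^ (L + 1))
        - 1 = ((1 - X) ^ (r + 1) * truncNegBinomial r L - 1) -
        X ^ (L + 1) * ((1 - X) ^ (r + 1) * C ((r + 1 + L).choose L : ℝ)) := by ring
    rw [this]
    exact dvd_sub ih (dvd_mul_right _ _)

open Polynomial in
/-- The Hermite basis polynomial for the `m`-th derivative at `0`. -/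
noncomputable def hermiteZero (r m : ℕ) : ℝ[X] :=
  (1 + X) ^ (r + 1) * (C (1 / (m.factorial : ℝ)) * (X ^ m * (truncNegBinomial r (r - m)).comp (-X)))

open Polynomial in
/-- The Hermite basis polynomial for the `m`-th derivative at `-1`. -/
noncomputable def hermiteNegOne (r m : ℕ) : ℝ[X] :=
  (-X) ^ (r + 1) *
    (C (1 / (m.factorial : ℝ)) * ((1 + X) ^ m * (truncNegBinomial r (r - m)).comp (1 + X)))

lemma hermite_eq_sum (r : ℕ) (F : Matrix (Fin 2) (Fin (r + 1)) ℝ) (x : ℝ) :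
    hermite r F x = ∑ m : Fin (r + 1),
      (F 0 m * (hermiteZero r m).eval x + F 1 m * (hermiteNegOne r m).eval x) := by
  rw [hermite, sum_add_distrib, mul_sum, mul_sum]
  congr 1
  · refine sum_congr rfl fun m _ => ?_
    simp only [hermiteZero, truncNegBinomial, Polynomial.eval_mul, Polynomial.eval_pow,
      Polynomial.eval_add, Polynomial.eval_one, Polynomial.eval_X, Polynomial.eval_C,
      Polynomial.eval_comp, Polynomial.eval_neg, Polynomial.eval_finsetSum]
    simp only [mul_sum]
    refine sum_congr rfl fun i _ => ?_
    rw [neg_pow x i]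
    ring
  · refine sum_congr rfl fun m _ => ?_
    simp only [hermiteNegOne, truncNegBinomial, Polynomial.eval_mul, Polynomial.eval_pow,
      Polynomial.eval_add, Polynomial.eval_one, Polynomial.eval_X, Polynomial.eval_C,
      Polynomial.eval_comp, Polynomial.eval_neg, Polynomial.eval_finsetSum]
    simp only [mul_sum]
    refine sum_congr rfl fun i _ => ?_
    ring

/-- The value at `x` of the `q`-th derivative of a polynomial. -/
noncomputable def polyJet (P : Polynomial ℝ) (q : ℕ) (x : ℝ) : ℝ :=
  (Polynomial.derivative^[q] P).eval x

open Polynomial in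
lemma polyJet_eq_zero_of_dvd {P : ℝ[X]} {c : ℝ} {r q : ℕ} (h : (X + C c) ^ (r + 1) ∣ P)
    (hq : q ≤ r) : polyJet P q (-c) = 0 := by
  obtain ⟨W, hW⟩ := pow_sub_dvd_iterate_derivative_of_pow_dvd q h
  rw [polyJet, hW, eval_mul, eval_pow]
  simp [show r + 1 - q ≠ 0 by omega]

-- Derivatives up to order `r` see `P` only modulo `(X + c)^(r+1)`, where it is the monomial `(X +
-- c)^m / m!`.
open Polynomial in
lemma polyJet_eq_ite {P : ℝ[X]} {c : ℝ} {r m q : ℕ}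
    (h : (X + C c) ^ (r + 1) ∣ P - C (1 / (m.factorial : ℝ)) * (X + C c) ^ m) (hq : q ≤ r) :
    polyJet P q (-c) = if q = m then 1 else 0 := by
  have h0 := polyJet_eq_zero_of_dvd h hq
  rw [polyJet, iterate_derivative_sub, eval_sub, sub_eq_zero] at h0
  rw [polyJet, h0, iterate_derivative_C_mul, iterate_derivative_X_add_pow]
  have hm : (m.factorial : ℝ) ≠ 0 := by exact_mod_cast m.factorial_ne_zero
  simp only [eval_mul, eval_C, eval_smul, eval_pow, eval_add, eval_X, neg_add_cancel]
  rcases lt_trichotomy q m with hlt | rfl | hgt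
  · rw [if_neg hlt.ne, zero_pow (by omega)]
    simp
  · simp [Nat.descFactorial_self, hm]
  · rw [if_neg hgt.ne', Nat.descFactorial_of_lt hgt]
    simp

-- After `X ↦ -X` the truncated series inverts `(1 + X)^(r+1)` modulo `X^(r-m+1)`; the factor `X^m`
-- raises this to the required order `r + 1`.
open Polynomial in
lemma polyJet_hermiteZero_zero {r m q : ℕ} (hm : m ≤ r) (hq : q ≤ r) :
    polyJet (hermiteZero r m) q 0 = if q = m then 1 else 0 := by
  rw [show polyJet (hermiteZero r m) q 0 = polyJet (hermiteZero r m) q (-0) by rw [neg_zero]]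
  refine polyJet_eq_ite (r := r) ?_ hq
  obtain ⟨W, hW⟩ := X_pow_dvd_truncNegBinomial r (r - m)
  have := congrArg (fun P => P.comp (-X : ℝ[X])) hW
  simp only [sub_comp, mul_comp, pow_comp, one_comp, X_comp, sub_neg_eq_add] at this
  have e : (1 + X) ^ (r + 1) * (truncNegBinomial r (r - m)).comp (-X) =
      1 + (-X) ^ (r - m + 1) * W.comp (-X) := by linear_combination this
  refine ⟨C (1 / (m.factorial : ℝ)) * (-1) ^ (r - m + 1) * W.comp (-X), ?_⟩
  rw [hermiteZero, show r + 1 = m + (r - m + 1) by omega, pow_add (X + C 0),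
    show m + (r - m + 1) = r + 1 by omega]
  rw [neg_pow (X : ℝ[X])] at e
  simp only [map_zero, add_zero]
  linear_combination (C (1 / (m.factorial : ℝ)) * X ^ m) * e

open Polynomial in
lemma polyJet_hermiteZero_neg_one {r m q : ℕ} (hq : q ≤ r) :
    polyJet (hermiteZero r m) q (-1) = 0 := by
  refine polyJet_eq_zero_of_dvd (r := r) ?_ hq
  rw [map_one, add_comm]
  exact dvd_mul_right _ _

open Polynomial in
lemma polyJet_hermiteNegOne_neg_one {r m q : ℕ} (hm : m ≤ r) (hq : q ≤ r) :
    polyJet (hermiteNegOne r m) q (-1) = if q = m then 1 else 0 := by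
  refine polyJet_eq_ite (r := r) ?_ hq
  obtain ⟨W, hW⟩ := X_pow_dvd_truncNegBinomial r (r - m)
  have := congrArg (fun P => P.comp (1 + X : ℝ[X])) hW
  simp only [sub_comp, mul_comp, pow_comp, one_comp, X_comp, sub_add_cancel_left] at this
  have e : (-X) ^ (r + 1) * (truncNegBinomial r (r - m)).comp (1 + X) =
      1 + (1 + X) ^ (r - m + 1) * W.comp (1 + X) := by linear_combination this
  refine ⟨C (1 / (m.factorial : ℝ)) * W.comp (1 + X), ?_⟩
  rw [hermiteNegOne, map_one, show r + 1 = m + (r - m + 1) by omega, pow_add (X + 1),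
    show m + (r - m + 1) = r + 1 by omega, add_comm X 1]
  linear_combination (C (1 / (m.factorial : ℝ)) * (1 + X) ^ m) * e

open Polynomial in
lemma polyJet_hermiteNegOne_zero {r m q : ℕ} (hq : q ≤ r) :
    polyJet (hermiteNegOne r m) q 0 = 0 := by
  rw [show polyJet (hermiteNegOne r m) q 0 = polyJet (hermiteNegOne r m) q (-0) by rw [neg_zero]]
  refine polyJet_eq_zero_of_dvd (r := r) ?_ hq
  rw [map_zero, add_zero, hermiteNegOne, neg_pow (X : ℝ[X]), mul_comm ((-1) ^ _), mul_assoc]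
  exact dvd_mul_right _ _

lemma hasExpansion_poly (P : Polynomial ℝ) (s : ℕ) {a b : ℝ} (hab : a ≤ b) :
    HasExpansion s (fun x => P.eval x) a b (fun i => polyJet P i a) (fun i => polyJet P i b) := by
  refine hasExpansion_of_jets hab (fun i x => polyJet P i x) s ?_ ?_
  · intro i _
    exact (Polynomial.continuous _).continuousOn
  · intro i _ x _
    simp only [polyJet, Function.iterate_succ_apply']
    exact Polynomial.hasDerivAt _ _

lemma HasExpansion.congr {s : ℕ} {g : ℝ → ℝ} {a b : ℝ} {A B A' B' : ℕ → ℝ}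
    (h : HasExpansion s g a b A B) (hA : ∀ i < s, A i = A' i) (hB : ∀ i < s, B i = B' i) :
    HasExpansion s g a b A' B' := by
  have : ∀ k, jetSum s A' B' a b k = jetSum s A B a b k := by
    intro k
    refine sum_congr rfl fun i hi => ?_
    rw [mem_range] at hi
    rw [hA i hi, hB i hi]
  simpa only [HasExpansion, this] using h

lemma hasExpansion_zero (s : ℕ) (a b : ℝ) : HasExpansion s (fun _ => 0) a b 0 0 :=
  ⟨0, fun k _ => by simp [fint, jetSum]⟩

/-- Interpolation error for a polynomial flat to order `m` at both ends of `[-1,0]`, extended by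
zero to `[0,1]`. -/
lemma flat_poly_error (m : ℕ) (hm : 1 ≤ m) (P : Polynomial ℝ)
    (h0 : ∀ i < m, polyJet P i 0 = 0) (h1 : ∀ i < m, polyJet P i (-1) = 0) :
    ∃ C, 0 ≤ C ∧ ∀ n : ℕ, 1 ≤ n → ∀ x ∈ Set.Icc (0 : ℝ) 1,
      ‖interp n (fun j => ((if (0 : ℝ) ≤ j / n then 0 else P.eval (j / n : ℝ) : ℝ) : ℂ)) x‖
        ≤ C / (n : ℝ) ^ m := by
  have := glued_error m hm (p := fun x => P.eval x) (g := fun _ => 0) (A := 0) (B := 0)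
    P.continuous.continuousOn continuousOn_const (h0 0 hm) (h1 0 hm)
    ((hasExpansion_poly P m (by norm_num)).congr h1 h0) (hasExpansion_zero m 0 1)
  simpa using this

/-! ### Jets of `f` and its Fourier expansion across break points -/

/-- The one-sided derivatives of `f` on `[0,1]`. -/
noncomputable def jet (f : ℝ → ℝ) (i : ℕ) : ℝ → ℝ := iteratedDerivWithin i f (Set.Icc 0 1)

lemma continuousOn_jet {r : ℕ} {f : ℝ → ℝ} (hf : ContDiffOn ℝ r f (Set.Icc 0 1)) {i : ℕ}
    (hi : i ≤ r) : ContinuousOn (jet f i) (Set.Icc 0 1) :=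
  hf.continuousOn_iteratedDerivWithin (by exact_mod_cast hi) (uniqueDiffOn_Icc one_pos)

lemma hasDerivWithinAt_jet {r : ℕ} {f : ℝ → ℝ} (hf : ContDiffOn ℝ r f (Set.Icc 0 1)) {i : ℕ}
    (hi : i < r) {x : ℝ} (hx : x ∈ Set.Icc (0 : ℝ) 1) :
    HasDerivWithinAt (jet f i) (jet f (i + 1) x) (Set.Icc 0 1) x := by
  have := hf.differentiableOn_iteratedDerivWithin (m := i) (by exact_mod_cast hi)
    (uniqueDiffOn_Icc one_pos) x hx
  rw [jet, jet, iteratedDerivWithin_succ]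
  exact this.hasDerivWithinAt

/-- Lipschitz continuity on `[a,b]` together with the first order Fourier expansion. -/
def LipschitzExpansion (φ : ℝ → ℝ) (a b : ℝ) : Prop :=
  (∃ K, 0 ≤ K ∧ ∀ x ∈ Set.Icc a b, ∀ y ∈ Set.Icc a b, x ≤ y → |φ y - φ x| ≤ K * (y - x)) ∧
    HasExpansion 1 φ a b (fun _ => φ a) (fun _ => φ b)

lemma lipschitzExpansion_of_hasDerivAt {φ ψ h : ℝ → ℝ} {a b : ℝ} (hab : a ≤ b)
    (hφ : ContinuousOn φ (Set.Icc a b)) (hψ : ContinuousOn ψ (Set.Icc a b))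
    (hh : ContinuousOn h (Set.Icc a b)) (h1 : ∀ x ∈ Set.Ioo a b, HasDerivAt φ (ψ x) x)
    (h2 : ∀ x ∈ Set.Ioo a b, HasDerivAt ψ (h x) x) : LipschitzExpansion φ a b := by
  constructor
  · obtain ⟨K, hK⟩ := isCompact_Icc.exists_bound_of_continuousOn hψ
    have hK0 : 0 ≤ K := (norm_nonneg _).trans (hK a ⟨le_rfl, hab⟩)
    refine ⟨K, hK0, fun x hx y hy hxy => ?_⟩
    rcases hxy.lt_or_eq with hlt | rfl
    · obtain ⟨c, hc, e⟩ := exists_hasDerivAt_eq_slope φ ψ hlt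
        (hφ.mono (Set.Icc_subset_Icc hx.1 hy.2))
        (fun z hz => h1 z ⟨hx.1.trans_lt hz.1, hz.2.trans_le hy.2⟩)
      have hc' := hK c ⟨hx.1.trans hc.1.le, hc.2.le.trans hy.2⟩
      rw [e, Real.norm_eq_abs, abs_div, abs_of_pos (sub_pos.2 hlt),
        div_le_iff₀ (sub_pos.2 hlt)] at hc'
      exact hc'
    · simp
  · let G : ℕ → ℝ → ℝ := fun i => if i = 0 then φ else if i = 1 then ψ else h
    have := hasExpansion_of_jets hab G 1 (by
      intro i hi
      interval_cases i <;> simpa [G]) (by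
      intro i hi
      interval_cases i
      · exact h1
      · exact h2)
    exact this.congr (by simp [G]) (by simp [G])

lemma lipschitzExpansion_self (φ : ℝ → ℝ) (a : ℝ) : LipschitzExpansion φ a a := by
  refine ⟨⟨0, le_rfl, fun x hx y hy _ => ?_⟩, 0, fun k _ => ?_⟩
  · rw [Set.Icc_self] at hx hy
    rw [hx, hy]
    simp
  · simp [fint, jetSum]

/-- The boundary terms at `b` from the two sides cancel, since both use the same value `φ b`. -/
lemma LipschitzExpansion.trans {φ : ℝ → ℝ} {a b c : ℝ} (hab : a ≤ b) (hbc : b ≤ c)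
    (hφ : ContinuousOn φ (Set.Icc a c)) (h1 : LipschitzExpansion φ a b)
    (h2 : LipschitzExpansion φ b c) : LipschitzExpansion φ a c := by
  obtain ⟨⟨K₁, hK₁, hL₁⟩, C₁, hC₁⟩ := h1
  obtain ⟨⟨K₂, hK₂, hL₂⟩, C₂, hC₂⟩ := h2
  constructor
  · refine ⟨K₁ + K₂, by positivity, fun x hx y hy hxy => ?_⟩
    rcases le_total y b with hyb | hby
    · have := hL₁ x ⟨hx.1, hxy.trans hyb⟩ y ⟨hy.1, hyb⟩ hxy
      nlinarith
    · rcases le_total x b with hxb | hbx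
      · have e1 := hL₁ x ⟨hx.1, hxb⟩ b ⟨hab, le_rfl⟩ hxb
        have e2 := hL₂ b ⟨le_rfl, hbc⟩ y ⟨hby, hy.2⟩ hby
        have e3 := abs_sub_le (φ y) (φ b) (φ x)
        nlinarith
      · have := hL₂ x ⟨hbx, hx.2⟩ y ⟨hby, hy.2⟩ hxy
        nlinarith
  · refine ⟨C₁ + C₂, fun k hk => ?_⟩
    have hint : ContinuousOn (fun x => (φ x : ℂ) * wave (-k) x) (Set.Icc a c) :=
      (Complex.continuous_ofReal.comp_continuousOn hφ).mul (continuous_wave _).continuousOn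
    have hsplit : fint φ a c k = fint φ a b k + fint φ b c k := by
      refine (intervalIntegral.integral_add_adjacent_intervals ?_ ?_).symm
      · apply ContinuousOn.intervalIntegrable
        rw [Set.uIcc_of_le hab]
        exact hint.mono (Set.Icc_subset_Icc le_rfl hbc)
      · apply ContinuousOn.intervalIntegrable
        rw [Set.uIcc_of_le hbc]
        exact hint.mono (Set.Icc_subset_Icc hab le_rfl)
    have e : fint φ a c k - jetSum 1 (fun _ => φ a) (fun _ => φ c) a c k =
        (fint φ a b k - jetSum 1 (fun _ => φ a) (fun _ => φ b) a b k) +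
        (fint φ b c k - jetSum 1 (fun _ => φ b) (fun _ => φ c) b c k) := by
      rw [hsplit]
      simp only [jetSum, sum_range_one]
      ring
    rw [e, add_div]
    exact (norm_add_le _ _).trans (add_le_add (hC₁ k hk) (hC₂ k hk))

lemma hasDerivAt_iteratedDeriv {f : ℝ → ℝ} {U : Set ℝ} (hU : IsOpen U) {m n : ℕ}
    (hf : ContDiffOn ℝ n f U) (hmn : m < n) {x : ℝ} (hx : x ∈ U) :
    HasDerivAt (iteratedDeriv m f) (iteratedDeriv (m + 1) f x) x := by
  have h := hf.differentiableOn_iteratedDerivWithin (m := m) (by exact_mod_cast hmn)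
    hU.uniqueDiffOn
  have h2 := (h.congr (fun y hy => (iteratedDerivWithin_of_isOpen hU hy).symm)).differentiableAt
    (hU.mem_nhds hx)
  rw [iteratedDeriv_succ]
  exact h2.hasDerivAt

/-- The derivative of order `r + 1` is known only on the open piece. Boundedness of the next one
makes it Lipschitz there, so it has a continuous extension `ψ` to the closed piece, as integration
by parts requires. -/
lemma lipschitzExpansion_jet_piece {r : ℕ} {f : ℝ → ℝ} (hf : ContDiffOn ℝ r f (Set.Icc 0 1))
    {a b : ℝ} (ha : 0 ≤ a) (hab : a < b) (hb : b ≤ 1)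
    (hpc : ContDiffOn ℝ ((r + 2 : ℕ) : WithTop ℕ∞) f (Set.Ioo a b)) {h : ℝ → ℝ}
    (hh : ContinuousOn h (Set.Icc a b))
    (heq : Set.EqOn (iteratedDeriv (r + 2) f) h (Set.Ioo a b)) :
    LipschitzExpansion (jet f r) a b := by
  have hsub : Set.Icc a b ⊆ Set.Icc 0 1 := Set.Icc_subset_Icc ha hb
  have hd0 : ∀ x ∈ Set.Ioo a b, HasDerivAt (iteratedDeriv r f) (iteratedDeriv (r + 1) f x) x :=
    fun x hx => hasDerivAt_iteratedDeriv isOpen_Ioo hpc (by omega) hx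
  have hd1 : ∀ x ∈ Set.Ioo a b, HasDerivAt (iteratedDeriv (r + 1) f) (h x) x := by
    intro x hx
    rw [← heq hx]
    exact hasDerivAt_iteratedDeriv isOpen_Ioo hpc (by omega) hx
  obtain ⟨M, hM⟩ := isCompact_Icc.exists_bound_of_continuousOn hh
  have hM0 : 0 ≤ M := (norm_nonneg _).trans (hM a ⟨le_rfl, hab.le⟩)
  have hlip : LipschitzOnWith ⟨M, hM0⟩ (iteratedDeriv (r + 1) f) (Set.Ioo a b) :=
    (convex_Ioo a b).lipschitzOnWith_of_nnnorm_hasDerivWithin_le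
      (fun x hx => (hd1 x hx).hasDerivWithinAt) (fun x hx => hM x ⟨hx.1.le, hx.2.le⟩)
  obtain ⟨ψ, hψ, hψe⟩ := hlip.extend_real
  refine lipschitzExpansion_of_hasDerivAt (ψ := ψ) (h := h) hab.le
    ((continuousOn_jet hf le_rfl).mono hsub) hψ.continuous.continuousOn hh ?_ ?_
  · intro x hx
    rw [← hψe hx]
    refine (hd0 x hx).congr_of_eventuallyEq ?_
    filter_upwards [isOpen_Ioo.mem_nhds hx] with y hy
    have hy' : y ∈ Set.Icc (0 : ℝ) 1 := hsub ⟨hy.1.le, hy.2.le⟩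
    refine iteratedDerivWithin_eq_iteratedDeriv (uniqueDiffOn_Icc one_pos) ?_ hy'
    exact ((hpc.contDiffAt (isOpen_Ioo.mem_nhds hy)).of_le (by exact_mod_cast (by omega)))
  · intro x hx
    refine (hd1 x hx).congr_of_eventuallyEq ?_
    filter_upwards [isOpen_Ioo.mem_nhds hx] with y hy
    exact (hψe hy).symm

lemma MemD.lipschitzExpansion_jet {r : ℕ} {f : ℝ → ℝ} (hf : MemD r f 0 1) :
    LipschitzExpansion (jet f r) 0 1 := by
  obtain ⟨hC, N, t, ht, h0, h1, hp⟩ := hf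
  have hlow : ∀ j, 0 ≤ t j := fun j => h0 ▸ ht.monotone (Fin.zero_le j)
  have hupp : ∀ j, t j ≤ 1 := fun j => h1 ▸ ht.monotone (Fin.le_last j)
  have key : ∀ j : Fin (N + 1), LipschitzExpansion (jet f r) (t 0) (t j) := by
    intro j
    induction j using Fin.induction with
    | zero => exact lipschitzExpansion_self _ _
    | succ j ih =>
      obtain ⟨hc, h, hh, he⟩ := hp j
      have hlt : t j.castSucc < t j.succ := ht j.castSucc_lt_succ
      refine ih.trans (ht.monotone (Fin.zero_le _)) hlt.le
        ((continuousOn_jet hC le_rfl).mono (Set.Icc_subset_Icc (hlow _) (hupp _))) ?_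
      exact lipschitzExpansion_jet_piece hC (hlow _) hlt (hupp _) hc hh he
  have := key (Fin.last N)
  rwa [h0, h1] at this

lemma jet_zero (f : ℝ → ℝ) : jet f 0 = f := iteratedDerivWithin_zero

/-- The first `r` integrations by parts run over all of `[0,1]`, ignoring break points. The last
boundary term and the error come from the first-order expansion of `jet f r`, divided by the `r`-th
power of the frequency. -/
lemma MemD.hasExpansion {r : ℕ} {f : ℝ → ℝ} (hf : MemD r f 0 1) :
    HasExpansion (r + 1) f 0 1 (fun i => jet f i 0) (fun i => jet f i 1) := by
  obtain ⟨C, hC⟩ := hf.lipschitzExpansion_jet.2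
  refine ⟨C, fun k hk => ?_⟩
  have h := fint_jets zero_le_one (jet f) r (fun i hi => continuousOn_jet hf.1 hi)
    (fun i hi x hx => (hasDerivWithinAt_jet hf.1 hi ⟨hx.1.le, hx.2.le⟩).hasDerivAt
      (Icc_mem_nhds hx.1 hx.2)) hk
  rw [jet_zero] at h
  have e : fint f 0 1 k - jetSum (r + 1) (fun i => jet f i 0) (fun i => jet f i 1) 0 1 k =
      (fint (jet f r) 0 1 k - jetSum 1 (fun _ => jet f r 0) (fun _ => jet f r 1) 0 1 k) /
        (Real.pi * Complex.I * k) ^ r := by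
    rw [h, jetSum, jetSum, sum_range_succ, jetSum, sum_range_one, zero_add, pow_one,
      sub_div (fint _ _ _ _),
      div_div, ← pow_succ']
    ring
  rw [e]
  refine (norm_div_freq_le hk r _ _ (hC k hk)).trans (le_of_eq ?_)
  rw [div_div, ← pow_add]
  congr 2
  omega

/-! ### Order conditions and accuracy of one-sided differences -/

lemma iteratedDeriv_pow_zero (m q : ℕ) :
    iteratedDeriv m (fun x : ℝ => x ^ q) 0 = if q = m then (m.factorial : ℝ) else 0 := by
  have h := congrFun (iteratedDeriv_eq_iterate (n := m) (f := fun x : ℝ => x ^ q)) 0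
  rw [h, iter_deriv_pow]
  rcases lt_trichotomy q m with h | rfl | h
  · rw [if_neg h.ne, prod_eq_zero (mem_range.2 h) (sub_self _), zero_mul]
  · rw [if_pos rfl, Nat.sub_self, pow_zero, mul_one, ← Nat.descFactorial_self,
      Nat.descFactorial_eq_prod_range, Nat.cast_prod]
    exact prod_congr rfl fun i hi => (Nat.cast_sub (mem_range.1 hi).le).symm
  · rw [if_neg h.ne', zero_pow (by omega), mul_zero]

/-- The order conditions satisfied by the coefficients of an accurate difference operator. -/
lemma HasAccuracy.sum_mul_pow {m p : ℕ} {c : ℕ → ℝ} (hc : HasAccuracy m p c) {q : ℕ}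
    (hq : q < m + p) :
    ∑ k ∈ range (m + p), c k * (k : ℝ) ^ q = if q = m then (m.factorial : ℝ) else 0 := by
  set S := ∑ k ∈ range (m + p), c k * (k : ℝ) ^ q with hS
  set D : ℝ := if q = m then (m.factorial : ℝ) else 0 with hD
  -- On `x ^ q` at `0` the operator equals `n^(m-q) * S`. Rescaling the accuracy bound by `n^(q-m)`
  -- makes the constant `S - D` of order `n^(q-m-p)`, hence `O(1/n)`, hence zero.
  have h := hc 1 (Or.inl rfl) (fun x => x ^ q) (contDiff_id.pow q) 0
  simp only [iteratedDeriv_pow_zero, ← hD] at h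
  have h2 := (Asymptotics.isBigO_refl (fun n : ℕ => (n : ℝ) ^ q / (n : ℝ) ^ m) Filter.atTop).mul h
  have hconst : (fun _ : ℕ => S - D) =O[Filter.atTop] fun n : ℕ => (1 : ℝ) / n := by
    refine ((Filter.EventuallyEq.isBigO ?_).trans h2).trans ?_
    · filter_upwards [Filter.eventually_ge_atTop 1] with n hn
      have hn0 : (n : ℝ) ≠ 0 := by exact_mod_cast (by omega : n ≠ 0)
      have e : finiteDiff 1 m p c n (fun x => x ^ q) 0 = (n : ℝ) ^ m / (n : ℝ) ^ q * S := by
        rw [finiteDiff, hS, mul_sum, mul_sum]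
        refine sum_congr rfl fun k _ => ?_
        rw [one_mul, one_mul, zero_add, div_pow]
        ring
      rw [e]
      by_cases hqm : q = m
      · rw [hqm]
        field_simp
      · simp only [hD, if_neg hqm, sub_zero]
        field_simp
    · refine Asymptotics.IsBigO.of_bound 1 ?_
      filter_upwards [Filter.eventually_ge_atTop 1] with n hn
      have hn0 : (0 : ℝ) < n := by exact_mod_cast hn
      have hn1 : (1 : ℝ) ≤ n := by exact_mod_cast hn
      rw [one_mul, Real.norm_of_nonneg (by positivity), Real.norm_of_nonneg (by positivity),
        div_mul_div_comm, mul_one, ← pow_add, div_le_div_iff₀ (by positivity) hn0, one_mul,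
        ← pow_succ]
      exact pow_le_pow_right₀ hn1 hq
  have hlim : Filter.Tendsto (fun _ : ℕ => S - D) Filter.atTop (nhds 0) :=
    hconst.trans_tendsto tendsto_one_div_atTop_nhds_zero_nat
  exact sub_eq_zero.1 (tendsto_nhds_unique tendsto_const_nhds hlim)

/-- Taylor's estimate when the last derivative is Lipschitz. -/
lemma abs_sub_taylor_le (G : ℕ → ℝ → ℝ) (r : ℕ) (K : ℝ)
    (hd : ∀ i < r, ∀ x ∈ Set.Icc (0 : ℝ) 1,
      HasDerivWithinAt (G i) (G (i + 1) x) (Set.Icc 0 1) x)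
    (hK : ∀ x ∈ Set.Icc (0 : ℝ) 1, ∀ y ∈ Set.Icc (0 : ℝ) 1, |G r x - G r y| ≤ K * |x - y|)
    {x₀ : ℝ} (hx₀ : x₀ ∈ Set.Icc (0 : ℝ) 1) {x : ℝ} (hx : x ∈ Set.Icc (0 : ℝ) 1) :
    |G 0 x - ∑ q ∈ range (r + 1), G q x₀ * (x - x₀) ^ q / q.factorial| ≤
      K * |x - x₀| ^ (r + 1) := by
  induction r generalizing G x with
  | zero => simpa using hK x hx x₀ hx₀
  | succ r ih =>
    have hsub : Set.uIcc x₀ x ⊆ Set.Icc 0 1 := Set.uIcc_subset_Icc hx₀ hx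
    -- The derivative of the Taylor remainder is the remainder of the shifted family, so induction
    -- bounds it and the mean value inequality gains one power of `|x - x₀|`.
    have hbound : ∀ y ∈ Set.uIcc x₀ x,
        ‖G 1 y - ∑ q ∈ range (r + 1), G (q + 1) x₀ * (y - x₀) ^ q / q.factorial‖ ≤
          K * |x - x₀| ^ (r + 1) := by
      intro y hy
      have hle : |y - x₀| ≤ |x - x₀| := Set.abs_sub_left_of_mem_uIcc hy
      have := ih (fun i => G (i + 1)) (fun i hi => hd (i + 1) (by omega)) hK (hsub hy)
      have hK0 : 0 ≤ K := by
        have := (abs_nonneg _).trans (hK 1 (by norm_num) 0 (by norm_num))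
        simpa using this
      exact this.trans (by gcongr)
    have hderiv : ∀ y ∈ Set.uIcc x₀ x, HasDerivWithinAt
        (fun y => G 0 y - ∑ q ∈ range (r + 1 + 1), G q x₀ * (y - x₀) ^ q / q.factorial)
        (G 1 y - ∑ q ∈ range (r + 1), G (q + 1) x₀ * (y - x₀) ^ q / q.factorial)
        (Set.uIcc x₀ x) y := by
      intro y hy
      refine ((hd 0 (by omega) y (hsub hy)).mono hsub).sub ?_
      simp only [sum_range_succ' _ (r + 1)]
      refine HasDerivAt.hasDerivWithinAt ?_
      simp only [pow_zero]
      refine HasDerivAt.add_const _ (HasDerivAt.fun_sum fun q _ => ?_)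
      have h1 := ((((hasDerivAt_id y).sub_const x₀).pow (q + 1)).const_mul
        (G (q + 1) x₀)).div_const ((q + 1).factorial : ℝ)
      have hq : (q.factorial : ℝ) ≠ 0 := by exact_mod_cast q.factorial_ne_zero
      have hq1 : (q : ℝ) + 1 ≠ 0 := by positivity
      have e : G (q + 1) x₀ * (y - x₀) ^ q / q.factorial =
          G (q + 1) x₀ * (((q + 1 : ℕ) : ℝ) * (id y - x₀) ^ (q + 1 - 1) * 1) /
            (q + 1).factorial := by
        rw [Nat.factorial_succ]
        push_cast
        simp only [id, mul_one]
        field_simp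
      rw [e]
      exact h1
    have := (convex_uIcc x₀ x).norm_image_sub_le_of_norm_hasDerivWithin_le hderiv hbound
      Set.left_mem_uIcc Set.right_mem_uIcc
    have hz : G 0 x₀ - ∑ q ∈ range (r + 1 + 1), G q x₀ * (x₀ - x₀) ^ q / q.factorial = 0 := by
      rw [sum_range_succ']
      simp
    rw [hz, sub_zero, Real.norm_eq_abs, Real.norm_eq_abs, mul_assoc, ← pow_succ] at this
    exact this

lemma MemD.exists_lipschitz_jet {r : ℕ} {f : ℝ → ℝ} (hf : MemD r f 0 1) {i : ℕ} (hi : i ≤ r) :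
    ∃ K, ∀ x ∈ Set.Icc (0 : ℝ) 1, ∀ y ∈ Set.Icc (0 : ℝ) 1,
      |jet f i x - jet f i y| ≤ K * |x - y| := by
  rcases hi.lt_or_eq with hlt | rfl
  · obtain ⟨K, hK⟩ := isCompact_Icc.exists_bound_of_continuousOn
      (continuousOn_jet hf.1 (i := i + 1) hlt)
    exact ⟨K, fun x hx y hy => (convex_Icc (0 : ℝ) 1).norm_image_sub_le_of_norm_hasDerivWithin_le
      (fun z hz => hasDerivWithinAt_jet hf.1 hlt hz) hK hy hx⟩
  · obtain ⟨⟨K, _, hK⟩, _⟩ := hf.lipschitzExpansion_jet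
    refine ⟨K, fun x hx y hy => ?_⟩
    rcases le_total x y with h | h
    · rw [abs_sub_comm, abs_sub_comm x, abs_of_nonneg (sub_nonneg.2 h)]
      exact hK x hx y hy h
    · rw [abs_of_nonneg (sub_nonneg.2 h)]
      exact hK y hy x hx h

lemma MemD.exists_taylor_bound {r : ℕ} {f : ℝ → ℝ} (hf : MemD r f 0 1) {Q : ℕ} (hQ : 1 ≤ Q)
    (hQr : Q ≤ r + 1) : ∃ K, ∀ x₀ ∈ Set.Icc (0 : ℝ) 1, ∀ x ∈ Set.Icc (0 : ℝ) 1,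
      |f x - ∑ q ∈ range Q, jet f q x₀ * (x - x₀) ^ q / q.factorial| ≤ K * |x - x₀| ^ Q := by
  obtain ⟨i, rfl⟩ : ∃ i, Q = i + 1 := ⟨Q - 1, by omega⟩
  obtain ⟨K, hK⟩ := hf.exists_lipschitz_jet (i := i) (by omega)
  refine ⟨K, fun x₀ hx₀ x hx => ?_⟩
  have := abs_sub_taylor_le (jet f) i K
    (fun j hj y hy => hasDerivWithinAt_jet hf.1 (by omega) hy) hK hx₀ hx
  rwa [jet_zero] at this

/-- The order conditions, available for all `q < Q` because `Q ≤ m + p`, annihilate every Taylor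
term except `q = m`, present because `m < Q`. Only the Taylor remainder at the nodes survives. The
backward case uses the same conditions, its signs cancelling through `σ * σ = 1`. -/
lemma abs_finiteDiff_sub_le {m p Q : ℕ} {c : ℕ → ℝ} (hc : HasAccuracy m p c)
    (hmQ : m < Q) (hQ : Q ≤ m + p) {σ : ℝ} (hσ : σ * σ = 1) {f : ℝ → ℝ} {x₀ : ℝ} {J : ℕ → ℝ}
    {K : ℝ} {n : ℕ} (hn : 1 ≤ n)
    (hK : ∀ k < m + p, |f (x₀ + σ * (k / n)) -
      ∑ q ∈ range Q, J q * (σ * (k / n)) ^ q / q.factorial| ≤ K * |σ * ((k : ℝ) / n)| ^ Q) :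
    |finiteDiff σ m p c n f x₀ - J m| ≤
      (∑ k ∈ range (m + p), |c k| * (K * (k : ℝ) ^ Q)) * ((n : ℝ) ^ m / (n : ℝ) ^ Q) := by
  have hn0 : (0 : ℝ) < n := by exact_mod_cast hn
  have habs : |σ| = 1 := by
    have : |σ| * |σ| = 1 := by rw [← abs_mul, hσ, abs_one]
    nlinarith [abs_nonneg σ]
  have hmain : (σ * n) ^ m * ∑ k ∈ range (m + p), c k *
      ∑ q ∈ range Q, J q * (σ * ((k : ℝ) / n)) ^ q / q.factorial = J m := by
    have e : ∑ k ∈ range (m + p), c k *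
        ∑ q ∈ range Q, J q * (σ * ((k : ℝ) / n)) ^ q / q.factorial =
        ∑ q ∈ range Q, J q * (σ / n) ^ q / q.factorial *
          ∑ k ∈ range (m + p), c k * (k : ℝ) ^ q := by
      simp only [mul_sum]
      rw [sum_comm]
      refine sum_congr rfl fun q _ => sum_congr rfl fun k _ => ?_
      rw [mul_pow, div_pow, div_pow]
      ring
    rw [e, sum_eq_single_of_mem m (mem_range.2 hmQ)]
    · rw [hc.sum_mul_pow (by omega), if_pos rfl]
      have hm : (m.factorial : ℝ) ≠ 0 := by exact_mod_cast m.factorial_ne_zero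
      have h1 : (σ * n) ^ m * (σ / n) ^ m = 1 := by
        rw [← mul_pow, show σ * n * (σ / n) = σ * σ by field_simp, hσ, one_pow]
      field_simp
      linear_combination J m * h1
    · intro q hq hne
      rw [hc.sum_mul_pow (by rw [mem_range] at hq; omega), if_neg hne, mul_zero]
  have e : finiteDiff σ m p c n f x₀ - J m = (σ * n) ^ m * ∑ k ∈ range (m + p), c k *
      (f (x₀ + σ * (k / n)) - ∑ q ∈ range Q, J q * (σ * ((k : ℝ) / n)) ^ q / q.factorial) := by
    rw [finiteDiff]
    simp only [mul_sub, sum_sub_distrib]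
    rw [hmain]
  rw [e, abs_mul, abs_pow, abs_mul, habs, one_mul, abs_of_pos hn0, mul_comm, sum_mul]
  calc _ ≤ (∑ k ∈ range (m + p), |c k| * (K * ((k : ℝ) / n) ^ Q)) * (n : ℝ) ^ m := by
        gcongr
        refine (abs_sum_le_sum_abs _ _).trans (sum_le_sum fun k hk => ?_)
        rw [abs_mul]
        have := hK k (mem_range.1 hk)
        rw [abs_mul σ, habs, one_mul, abs_of_nonneg (by positivity : (0 : ℝ) ≤ k / n)] at this
        gcongr
    _ = _ := by
        rw [sum_mul]
        refine sum_congr rfl fun k _ => ?_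
        rw [div_pow]
        ring

/-- Uniform accuracy of the one-sided differences at the end points of `[0,1]`. -/
lemma MemD.exists_finiteDiff_bound {r p : ℕ} {f : ℝ → ℝ} (hf : MemD r f 0 1) (hp : 1 ≤ p) {m : ℕ}
    (hm : m ≤ r) {c : ℕ → ℝ} (hc : HasAccuracy m p c) :
    ∃ C, 0 ≤ C ∧ ∀ n : ℕ, 1 ≤ n → r + p ≤ n + 1 →
      |finiteDiff 1 m p c n f 0 - jet f m 0| ≤
        C * ((n : ℝ) ^ m / (n : ℝ) ^ min (m + p) (r + 1)) ∧
      |finiteDiff (-1) m p c n f 1 - jet f m 1| ≤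
        C * ((n : ℝ) ^ m / (n : ℝ) ^ min (m + p) (r + 1)) := by
  -- The Taylor length is capped by the order conditions at `m + p` and by the smoothness of `f` at
  -- `r + 1`.
  set Q := min (m + p) (r + 1) with hQ
  obtain ⟨K, hK⟩ := hf.exists_taylor_bound (Q := Q) (by omega) (by omega)
  have hK0 : 0 ≤ K := by
    have := (abs_nonneg _).trans (hK 0 (by norm_num) 1 (by norm_num))
    simpa using this
  refine ⟨∑ k ∈ range (m + p), |c k| * (K * (k : ℝ) ^ Q), by positivity, fun n hn hrn => ?_⟩
  have hn0 : (0 : ℝ) < n := by exact_mod_cast hn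
  -- Here `r + p ≤ n + 1` keeps all nodes in `[0,1]`: `k ≤ m + p - 1 ≤ n`.
  have hnode : ∀ k < m + p, 0 ≤ (k : ℝ) / n ∧ (k : ℝ) / n ≤ 1 := by
    intro k hk
    refine ⟨by positivity, ?_⟩
    rw [div_le_one hn0]
    exact_mod_cast (by omega : k ≤ n)
  constructor
  · refine abs_finiteDiff_sub_le hc (by omega) (by omega) (by norm_num) (J := fun q => jet f q 0)
      hn fun k hk => ?_
    have h := hnode k hk
    have := hK 0 (by norm_num) (0 + 1 * ((k : ℝ) / n)) ⟨by linarith, by linarith⟩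
    rwa [add_sub_cancel_left] at this
  · refine abs_finiteDiff_sub_le hc (by omega) (by omega) (by norm_num) (J := fun q => jet f q 1)
      hn fun k hk => ?_
    have h := hnode k hk
    have := hK 1 (by norm_num) (1 + -1 * ((k : ℝ) / n)) ⟨by linarith, by linarith⟩
    rwa [add_sub_cancel_left] at this

/-! ### Splitting off the boundary errors and assembling the bound -/

/-- The Hermite interpolation polynomial of the exact boundary derivatives. -/
noncomputable def exactHermite (r : ℕ) (f : ℝ → ℝ) : Polynomial ℝ :=
  ∑ m : Fin (r + 1), (Polynomial.C (jet f m 0) * hermiteZero r m +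
    Polynomial.C (jet f m 1) * hermiteNegOne r m)

lemma polyJet_exactHermite (r : ℕ) (f : ℝ → ℝ) (q : ℕ) (x : ℝ) :
    polyJet (exactHermite r f) q x = ∑ m : Fin (r + 1),
      (jet f m 0 * polyJet (hermiteZero r m) q x +
        jet f m 1 * polyJet (hermiteNegOne r m) q x) := by
  simp only [polyJet, exactHermite, Polynomial.iterate_derivative_sum, Polynomial.eval_finsetSum,
    iterate_map_add, Polynomial.eval_add, Polynomial.iterate_derivative_C_mul,
    Polynomial.eval_mul, Polynomial.eval_C]

lemma polyJet_exactHermite_zero {r q : ℕ} (hq : q ≤ r) (f : ℝ → ℝ) :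
    polyJet (exactHermite r f) q 0 = jet f q 0 := by
  rw [polyJet_exactHermite, Fintype.sum_eq_single (⟨q, by omega⟩ : Fin (r + 1))]
  · rw [polyJet_hermiteZero_zero hq hq, polyJet_hermiteNegOne_zero hq]
    simp
  · intro m hm
    have hm' : q ≠ (m : ℕ) := fun h => hm (Fin.ext h.symm)
    rw [polyJet_hermiteZero_zero (by omega) hq, polyJet_hermiteNegOne_zero hq, if_neg hm']
    simp

lemma polyJet_exactHermite_neg_one {r q : ℕ} (hq : q ≤ r) (f : ℝ → ℝ) :
    polyJet (exactHermite r f) q (-1) = jet f q 1 := by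
  rw [polyJet_exactHermite, Fintype.sum_eq_single (⟨q, by omega⟩ : Fin (r + 1))]
  · rw [polyJet_hermiteZero_neg_one hq, polyJet_hermiteNegOne_neg_one hq hq]
    simp
  · intro m hm
    have hm' : q ≠ (m : ℕ) := fun h => hm (Fin.ext h.symm)
    rw [polyJet_hermiteZero_neg_one hq, polyJet_hermiteNegOne_neg_one (by omega) hq, if_neg hm']
    simp

/-- Interpolation error when the continuation uses the exact boundary derivatives. -/
lemma MemD.exact_error {r : ℕ} {f : ℝ → ℝ} (hf : MemD r f 0 1) :
    ∃ C, 0 ≤ C ∧ ∀ n : ℕ, 1 ≤ n → ∀ x ∈ Set.Icc (0 : ℝ) 1,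
      ‖interp n (fun j => ((if (0 : ℝ) ≤ j / n then f (j / n) else
        (exactHermite r f).eval (j / n : ℝ) : ℝ) : ℂ)) x - f x‖ ≤ C / (n : ℝ) ^ (r + 1) := by
  refine glued_error (r + 1) (by omega) (p := fun x => (exactHermite r f).eval x)
    (exactHermite r f).continuous.continuousOn hf.1.continuousOn ?_ ?_
    ((hasExpansion_poly _ (r + 1) (by norm_num)).congr
      (fun i hi => polyJet_exactHermite_neg_one (by omega) f)
      (fun i hi => polyJet_exactHermite_zero (by omega) f)) hf.hasExpansion
  · have := polyJet_exactHermite_zero (Nat.zero_le r) f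
    rwa [jet_zero] at this
  · have := polyJet_exactHermite_neg_one (Nat.zero_le r) f
    rwa [jet_zero] at this

/-- Grid data of a polynomial on the negative half of the grid, extended by zero. -/
noncomputable def negPart (P : Polynomial ℝ) (n : ℕ) (j : ℤ) : ℂ :=
  ((if (0 : ℝ) ≤ j / n then 0 else P.eval (j / n : ℝ) : ℝ) : ℂ)

lemma interp_add (n : ℕ) (u v : ℤ → ℂ) (x : ℝ) :
    interp n (fun j => u j + v j) x = interp n u x + interp n v x := by
  simp only [interp, add_mul, sum_add_distrib]

lemma interp_const_mul (n : ℕ) (c : ℂ) (u : ℤ → ℂ) (x : ℝ) :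
    interp n (fun j => c * u j) x = c * interp n u x := by
  simp only [interp, mul_sum (s := Ico (-(n : ℤ)) n), mul_assoc]

lemma interp_sum {ι : Type*} (s : Finset ι) (n : ℕ) (u : ι → ℤ → ℂ) (x : ℝ) :
    interp n (fun j => ∑ i ∈ s, u i j) x = ∑ i ∈ s, interp n (u i) x := by
  simp only [interp]
  rw [sum_comm]
  exact sum_congr rfl fun j _ => sum_mul _ _ _

lemma trigInterp_continuedData (r p : ℕ) (a : ℕ → ℕ → ℝ) (f : ℝ → ℝ) (n : ℕ) (hn : 1 ≤ n)
    (x : ℝ) :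
    trigInterp n (continuedData r p a n f) x =
      interp n (fun j => ((if (0 : ℝ) ≤ j / n then f (j / n) else
        (exactHermite r f).eval (j / n : ℝ) : ℝ) : ℂ)) x +
      ∑ m : Fin (r + 1),
        (((boundaryData r p a n f 0 m - jet f m 0 : ℝ) : ℂ) *
            interp n (negPart (hermiteZero r m) n) x +
          ((boundaryData r p a n f 1 m - jet f m 1 : ℝ) : ℂ) *
            interp n (negPart (hermiteNegOne r m) n) x) := by
  have hn0 : (0 : ℝ) < n := by exact_mod_cast hn
  simp only [← interp_const_mul, ← interp_add, ← interp_sum]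
  rw [trigInterp_eq_interp]
  congr 1
  ext j
  have hj : (0 : ℝ) ≤ j / n ↔ 0 ≤ j := by
    rw [le_div_iff₀ hn0, zero_mul]
    exact_mod_cast Iff.rfl
  by_cases h : 0 ≤ j
  · simp [continuedData, negPart, hj, h]
  · simp only [continuedData, negPart, hj, h, if_false, hermite_eq_sum, exactHermite,
      Polynomial.eval_finsetSum, Polynomial.eval_add, Polynomial.eval_mul, Polynomial.eval_C]
    norm_cast
    rw [← sum_add_distrib]
    refine sum_congr rfl fun m _ => ?_
    ring

/-- The loss `n^m` in the difference quotient is offset exactly by the factor `n^{-m}` from the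
order-`m` flatness of the basis polynomials. -/
lemma MemD.boundary_term_bound {r p : ℕ} (hp : 1 ≤ p) {a : ℕ → ℕ → ℝ}
    (ha : ∀ m : ℕ, 1 ≤ m → m ≤ r → HasAccuracy m p (a m)) {f : ℝ → ℝ} (hf : MemD r f 0 1)
    (m : Fin (r + 1)) :
    ∃ C, 0 ≤ C ∧ ∀ n : ℕ, 1 ≤ n → r + p ≤ n + 1 → ∀ x ∈ Set.Icc (0 : ℝ) 1,
      ‖((boundaryData r p a n f 0 m - jet f m 0 : ℝ) : ℂ) *
            interp n (negPart (hermiteZero r m) n) x +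
          ((boundaryData r p a n f 1 m - jet f m 1 : ℝ) : ℂ) *
            interp n (negPart (hermiteNegOne r m) n) x‖ ≤ C / (n : ℝ) ^ (min p r + 1) := by
  have hmr : (m : ℕ) ≤ r := by omega
  by_cases hm : (m : ℕ) = 0
  · refine ⟨0, le_rfl, fun n _ _ x _ => ?_⟩
    obtain rfl : m = 0 := Fin.ext hm
    simp [boundaryData, jet_zero]
  · have hm1 : 1 ≤ (m : ℕ) := by omega
    have hm0 : m ≠ 0 := fun h => hm (by simp [h])
    obtain ⟨D, hD, hd⟩ := hf.exists_finiteDiff_bound hp hmr (ha m hm1 hmr)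
    obtain ⟨C₀, hC₀, h0⟩ := flat_poly_error m hm1 (hermiteZero r m)
      (fun i hi => by rw [polyJet_hermiteZero_zero hmr (by omega), if_neg hi.ne])
      (fun i hi => polyJet_hermiteZero_neg_one (by omega))
    obtain ⟨C₁, hC₁, h1⟩ := flat_poly_error m hm1 (hermiteNegOne r m)
      (fun i hi => polyJet_hermiteNegOne_zero (by omega))
      (fun i hi => by rw [polyJet_hermiteNegOne_neg_one hmr (by omega), if_neg hi.ne])
    refine ⟨D * (C₀ + C₁), by positivity, fun n hn hrn x hx => ?_⟩
    have hn0 : (0 : ℝ) < n := by exact_mod_cast hn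
    have hn1 : (1 : ℝ) ≤ n := by exact_mod_cast hn
    obtain ⟨e0, e1⟩ := hd n hn hrn
    have b0 : |boundaryData r p a n f 0 m - jet f m 0| ≤
        D * ((n : ℝ) ^ (m : ℕ) / (n : ℝ) ^ min ((m : ℕ) + p) (r + 1)) := by
      simpa [boundaryData, hm0] using e0
    have b1 : |boundaryData r p a n f 1 m - jet f m 1| ≤
        D * ((n : ℝ) ^ (m : ℕ) / (n : ℝ) ^ min ((m : ℕ) + p) (r + 1)) := by
      simpa [boundaryData, hm0] using e1
    have i0 := h0 n hn x hx
    have i1 := h1 n hn x hx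
    refine (norm_add_le _ _).trans ?_
    rw [norm_mul, norm_mul, Complex.norm_real, Complex.norm_real, Real.norm_eq_abs,
      Real.norm_eq_abs]
    calc _ ≤ D * ((n : ℝ) ^ (m : ℕ) / (n : ℝ) ^ min ((m : ℕ) + p) (r + 1)) *
            (C₀ / (n : ℝ) ^ (m : ℕ)) +
          D * ((n : ℝ) ^ (m : ℕ) / (n : ℝ) ^ min ((m : ℕ) + p) (r + 1)) *
            (C₁ / (n : ℝ) ^ (m : ℕ)) := by
          exact add_le_add (mul_le_mul b0 i0 (norm_nonneg _) (by positivity))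
            (mul_le_mul b1 i1 (norm_nonneg _) (by positivity))
      _ = D * (C₀ + C₁) / (n : ℝ) ^ min ((m : ℕ) + p) (r + 1) := by
          field_simp
      _ ≤ D * (C₀ + C₁) / (n : ℝ) ^ (min p r + 1) := by
          refine div_le_div_of_nonneg_left (by positivity) (by positivity)
            (pow_le_pow_right₀ hn1 ?_)
          -- Uses `m ≥ 1`: `min (m + p) (r + 1) ≥ min p r + 1`.
          omega

end FourierContinuation

theorem mainTheorem5 (r p : ℕ) (hp : 1 ≤ p) (a : ℕ → ℕ → ℝ)
    (ha : ∀ m : ℕ, 1 ≤ m → m ≤ r → FourierContinuation.HasAccuracy m p (a m))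
    (f : ℝ → ℝ) (hf : FourierContinuation.MemD r f 0 1) :
    ∃ C : ℝ, 0 < C ∧ ∀ n : ℕ, 1 ≤ n → r + p ≤ n + 1 → ∀ x ∈ Set.Icc (0 : ℝ) 1,
      ‖FourierContinuation.trigInterp n (FourierContinuation.continuedData r p a n f) x
          - (f x : ℂ)‖ ≤ C / (n : ℝ) ^ (min p r + 1) := by
  obtain ⟨C, hC, h⟩ := hf.exact_error
  choose D hD hd using fun m => hf.boundary_term_bound hp ha m
  have hsum : 0 ≤ ∑ m, D m := Finset.sum_nonneg fun m _ => hD m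
  -- The summand `1` only makes the constant strictly positive.
  refine ⟨C + ∑ m, D m + 1, by positivity, fun n hn hrn x hx => ?_⟩
  have hn1 : (1 : ℝ) ≤ n := by exact_mod_cast hn
  have hn0 : (0 : ℝ) < n := by positivity
  rw [FourierContinuation.trigInterp_continuedData r p a f n hn x, add_sub_right_comm]
  calc _ ≤ C / (n : ℝ) ^ (r + 1) + ∑ m, D m / (n : ℝ) ^ (min p r + 1) :=
        (norm_add_le _ _).trans (add_le_add (h n hn x hx)
          (norm_sum_le_of_le _ fun m _ => hd m n hn hrn x hx))
    _ ≤ C / (n : ℝ) ^ (min p r + 1) + ∑ m, D m / (n : ℝ) ^ (min p r + 1) := by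
        gcongr
        exact min_le_right p r
    _ = (C + ∑ m, D m) / (n : ℝ) ^ (min p r + 1) := by rw [← Finset.sum_div, add_div]
    _ ≤ _ := by
        exact div_le_div_of_nonneg_right (by linarith) (by positivity)
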